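/- Let $A\in\mathbb R^{d_x\times d_x}$, $B_u\in\mathbb R^{d_x\times d_u}$, $B_w\in\mathbb R^{d_x\times 1}$ with $(A,B_u)$ and $(A,B_w)$ stabilizable, and consider the system $x_{t+1}=Ax_t+B_uu_t+B_ww_t$ with scalar disturbance $w_t$ and cost $\|x_t\|^2+\|u_t\|^2$. Let $F(z)=(zI-A)^{-1}B_u$, $G(z)=(zI-A)^{-1}B_w$. An admissible controller is a causal, bounded, linear time-invariant map $w\mapsto u=Kw$ (real Markov parameters, transfer function $K\in H_\infty$) whose closed loop $$T_K(e^{j\omega})=\begin{bmatrix}F(e^{j\omega})K(e^{j\omega})+G(e^{j\omega})\\ K(e^{j\omega})\end{bmatrix}$$ is causal and bounded as well (automatic when $A$ is Schur stable). Put $\|T_K\|_2^2=\frac1{2\pi}\int_0^{2\pi}\|T_K(e^{j\omega})\|^2d\omega$ and $\|T_K\|_\infty=\operatorname{ess\,sup}_\omega\|T_K(e^{j\omega})\|$. Let $\gamma_\infty=\inf_K\|T_K\|_\infty$ over admissible $K$, let $\gamma_2=\|T_{K_2}\|_\infty$, where $K_2$ is the admissible controller of least $\|T_K\|_2$, and let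 $\gamma\in(\gamma_\infty,\gamma_2)$. An optimal mixed $H_2/H_\infty$ controller $K_\gamma$ is a minimizer of $\|T_K\|_2^2$ over the admissible $K$ with $\|T_K\|_\infty\le\gamma$. An optimal spectrum is $N_\gamma=L_\gamma^*L_\gamma$, where $L_\gamma L_\gamma^*=1+\Lambda_\gamma$ (so that $N_\gamma=1+\Lambda_\gamma$ on the circle) and $(K,\Lambda_\gamma)$ is a saddle point, minimizing over admissible $K$ and maximizing over $\Lambda\in L_1$, $\Lambda\ge0$, of $$\frac1{2\pi}\int_0^{2\pi}\|T_K(e^{j\omega})\|^2\,(1+\Lambda(e^{j\omega}))\,d\omega-\gamma^2\,\frac1{2\pi}\int_0^{2\pi}\Lambda(e^{j\omega})\,d\omega .$$ Then $K_\gamma$ exists and is unique up to null sets; no optimal spectrum $N_\gamma(e^{j\omega})$ agrees almost everywhere with a rational function of $e^{j\omega}$; and $K_\gamma(e^{j\omega})$ is not (almost everywhere) a rational function of $e^{j\omega}$, that is, not all of its entries are rational. Consequently $K_\gamma$ has no finite-dimensional state-space realization: there are no matrices $a,b,c,d$ of finite size such that its Markov parameters are $d,\ cb,\ cab,\ ca^2b,\dots$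 -/

import Mathlib

open MeasureTheory

noncomputable section

namespace MixedControl

/-- Frequencies `ω`, taken modulo `2π`. -/
abbrev Freq : Type := AddCircle (2 * Real.pi)

instance factTwoPiPos : Fact (0 < 2 * Real.pi) := ⟨Real.two_pi_pos⟩

/-- The normalized measure `dω / 2π` on the frequencies. -/
abbrev freqMeasure : Measure Freq := AddCircle.haarAddCircle

/-- The point `e^{jω}` of the unit circle. -/
def expj (ω : Freq) : ℂ := (AddCircle.toCircle ω : ℂ)

/-- The Fourier coefficient `f̂_t = ∫ f(e^{jω}) e^{jωt} dω/2π`, so that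
`f(e^{jω}) = ∑ t, f̂_t e^{-jωt}`: the Markov parameters of the Laurent operator with symbol `f`. -/
def markov {ι : Type} [Fintype ι] (f : Freq → EuclideanSpace ℂ ι) (t : ℤ) : EuclideanSpace ℂ ι :=
  fourierCoeff f (-t)

/-- The Hardy class `H_∞` of (column) symbols: essentially bounded on the unit circle, causal, and
with real Markov parameters (the signals are real). -/
structure IsHInf {ι : Type} [Fintype ι] (f : Freq → EuclideanSpace ℂ ι) : Prop where
  memLp : MemLp f ⊤ freqMeasure
  causal : ∀ t : ℤ, t < 0 → markov f t = 0
  real : ∀ (t : ℤ) (i : ι), (markov f t i).im = 0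

/-- `(A, B)` is stabilizable: some state feedback makes `A + B F` Schur stable. -/
def IsStabilizable {n m : ℕ} (A : Matrix (Fin n) (Fin n) ℝ) (B : Matrix (Fin n) (Fin m) ℝ) : Prop :=
  ∃ F : Matrix (Fin m) (Fin n) ℝ,
    ∀ μ ∈ spectrum ℂ ((A + B * F).map (algebraMap ℝ ℂ)), ‖μ‖ < 1

/-- The system `x_{t+1} = A x_t + B_u u_t + B_w w_t` with scalar disturbance `w_t`. -/
structure LTISystem (dx du : ℕ) where
  A : Matrix (Fin dx) (Fin dx) ℝ
  Bu : Matrix (Fin dx) (Fin du) ℝ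
  Bw : Matrix (Fin dx) (Fin 1) ℝ

namespace LTISystem

variable {dx du : ℕ} (S : LTISystem dx du)

/-- `F(e^{jω}) = (e^{jω} I - A)⁻¹ B_u`. -/
def F (ω : Freq) : Matrix (Fin dx) (Fin du) ℂ :=
  (expj ω • (1 : Matrix (Fin dx) (Fin dx) ℂ) - S.A.map (algebraMap ℝ ℂ))⁻¹ *
    S.Bu.map (algebraMap ℝ ℂ)

/-- `G(e^{jω}) = (e^{jω} I - A)⁻¹ B_w`. -/
def G (ω : Freq) : Matrix (Fin dx) (Fin 1) ℂ :=
  (expj ω • (1 : Matrix (Fin dx) (Fin dx) ℂ) - S.A.map (algebraMap ℝ ℂ))⁻¹ *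
    S.Bw.map (algebraMap ℝ ℂ)

/-- The closed-loop transfer column `T_K(e^{jω}) = [F K + G; K]`. -/
def closedLoop (K : Freq → EuclideanSpace ℂ (Fin du)) (ω : Freq) :
    EuclideanSpace ℂ (Fin dx ⊕ Fin du) :=
  WithLp.toLp 2 (Sum.elim
    (fun i => (S.F ω).mulVec (K ω).ofLp i + S.G ω i 0)
    (fun i => K ω i))

/-- Causal bounded controllers `w ↦ u` whose closed loop `w ↦ (x, u)` is causal and bounded as well.
If `A` is Schur stable, the second condition follows from the first. -/
def IsAdmissible (K : Freq → EuclideanSpace ℂ (Fin du)) : Prop :=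
  IsHInf K ∧ IsHInf (S.closedLoop K)

/-- `‖T_K‖²` for the `H_2` norm. -/
def h2NormSq (K : Freq → EuclideanSpace ℂ (Fin du)) : ℝ :=
  ∫ ω, ‖S.closedLoop K ω‖ ^ 2 ∂freqMeasure

/-- `‖T_K‖` for the `H_∞` norm, the essential supremum over the unit circle of the largest singular
value of `T_K(e^{jω})`, which is the Euclidean norm of this column. -/
def hInfNorm (K : Freq → EuclideanSpace ℂ (Fin du)) : ℝ :=
  (eLpNorm (S.closedLoop K) ⊤ freqMeasure).toReal

/-- `K` is the optimal `H_2` controller. -/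
def IsH2Optimal (K : Freq → EuclideanSpace ℂ (Fin du)) : Prop :=
  S.IsAdmissible K ∧ ∀ K', S.IsAdmissible K' → S.h2NormSq K ≤ S.h2NormSq K'

/-- `γ_∞`, the least achievable closed-loop `H_∞` norm. -/
def gammaInf : ℝ := sInf (S.hInfNorm '' {K | S.IsAdmissible K})

/-- `γ_2`, the closed-loop `H_∞` norm of the optimal `H_2` controller. The `H_2` optimal controller
is unique up to null sets, so the set below is a singleton. -/
def gammaTwo : ℝ := sInf (S.hInfNorm '' {K | S.IsH2Optimal K})

/-- `K` is an optimal mixed `H_2/H_∞` controller for the bound `γ`. -/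
def IsMixedOptimal (γ : ℝ) (K : Freq → EuclideanSpace ℂ (Fin du)) : Prop :=
  S.IsAdmissible K ∧ S.hInfNorm K ≤ γ ∧
    ∀ K', S.IsAdmissible K' → S.hInfNorm K' ≤ γ → S.h2NormSq K ≤ S.h2NormSq K'

/-- Dual variables: nonnegative elements of `L_1` of the circle. -/
def IsDualFeasible (Λ : Freq → ℝ) : Prop :=
  Integrable Λ freqMeasure ∧ 0 ≤ᵐ[freqMeasure] Λ

/-- The Lagrangian `tr(T_K^* T_K (I + Λ)) - γ² tr(Λ)`. -/
def lagrangian (γ : ℝ) (K : Freq → EuclideanSpace ℂ (Fin du)) (Λ : Freq → ℝ) : ℝ :=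
  ∫ ω, ‖S.closedLoop K ω‖ ^ 2 * (1 + Λ ω) ∂freqMeasure - γ ^ 2 * ∫ ω, Λ ω ∂freqMeasure

/-- `(K, Λ)` is a saddle point of `max_{Λ ≥ 0} min_K` of the Lagrangian. -/
def IsSaddlePoint (γ : ℝ) (K : Freq → EuclideanSpace ℂ (Fin du)) (Λ : Freq → ℝ) : Prop :=
  S.IsAdmissible K ∧ IsDualFeasible Λ ∧
    (∀ Λ', IsDualFeasible Λ' → S.lagrangian γ K Λ' ≤ S.lagrangian γ K Λ) ∧
    (∀ K', S.IsAdmissible K' → S.lagrangian γ K Λ ≤ S.lagrangian γ K' Λ)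

/-- `N` is the optimal spectrum `N_γ = L^* L`, where `L L^* = I + Λ` is the spectral factorization
at a saddle point `(K, Λ)`; for scalar disturbances `L^* L = L L^* = 1 + Λ` on the circle. -/
def IsOptimalSpectrum (γ : ℝ) (N : Freq → ℝ) : Prop :=
  ∃ K Λ, S.IsSaddlePoint γ K Λ ∧ N =ᵐ[freqMeasure] fun ω => 1 + Λ ω

end LTISystem

/-- `f` is (almost everywhere on the circle) a rational function of `e^{jω}`. -/
def IsRational (f : Freq → ℂ) : Prop :=
  ∃ p q : Polynomial ℂ, q ≠ 0 ∧
    f =ᵐ[freqMeasure] fun ω => p.eval (expj ω) / q.eval (expj ω)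

/-- The vector symbol `K` is rational: all of its entries are. -/
def IsRationalVec {m : ℕ} (K : Freq → EuclideanSpace ℂ (Fin m)) : Prop :=
  ∀ i, IsRational fun ω => K ω i

/-- The controller `K` is realized by a finite-dimensional model `s_{t+1} = a s_t + b w_t`,
`u_t = c s_t + d w_t`: its Markov parameters are `d, c b, c a b, c a² b, …`. Complex coefficients
are allowed, which includes the real ones. -/
def HasStateSpaceRealization {m : ℕ} (K : Freq → EuclideanSpace ℂ (Fin m)) : Prop :=
  ∃ (n : ℕ) (a : Matrix (Fin n) (Fin n) ℂ) (b : Fin n → ℂ) (c : Matrix (Fin m) (Fin n) ℂ)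
    (d : Fin m → ℂ), (markov K 0).ofLp = d ∧
      ∀ t : ℕ, (markov K ((t : ℤ) + 1)).ofLp = c.mulVec ((a ^ t).mulVec b)

end MixedControl

end

open Filter Topology Polynomial

noncomputable section

namespace MixedControl

/-! Suppose a mixed optimal `K` is rational. On the circle conjugation sends `e^{jω}` to its
inverse, so the slack `γ² - ‖T_K‖²` is a rational function: it vanishes almost everywhere or has
only finitely many zeros. If it vanishes, the cost of `K` is `γ²`, while a controller with `‖T‖_∞ <
γ` costs strictly less.

Otherwise the slack dominates a multiple of `∏ |e^{jω} - α|` with `|α| = 1`. Moving from `K` towards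
the `H_2` optimum `K'` through a real causal filter divisible by `conjProd M` respects the
constraint for small steps of both signs, so the cost is stationary in all these directions
(`IsMixedOptimal.stationary`). As a functional of the filter, the slope has moments tending to zero,
being real parts of Fourier coefficients of a bounded function. Vanishing on the multiples of
`conjProd M` makes the moments solve a linear recurrence with unimodular characteristic roots, and
the only decaying solution is zero (`real_functional_eq_zero`). Hence the slope towards `K'` itself
is zero and `K` is `H_2` optimal, contradicting `γ < γ_2`.

For the spectrum, complementary slackness replaces the perturbation argument: a rational `Λ` is zero
almost everywhere, making `K` `H_2` optimal, or nonzero almost everywhere, making the constraint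
active almost everywhere. Existence and uniqueness are those of the least-norm point of a closed
convex set in `L_2`. A finite-dimensional realization forces rationality by Cayley–Hamilton. -/

lemma norm_expj (ω : Freq) : ‖expj ω‖ = 1 := Circle.norm_coe _

lemma expj_ne_zero (ω : Freq) : expj ω ≠ 0 := Circle.coe_ne_zero _

lemma norm_expj_inv (ω : Freq) : ‖(expj ω)⁻¹‖ = 1 := by rw [norm_inv, norm_expj, inv_one]

lemma conj_expj (ω : Freq) : star (expj ω) = (expj ω)⁻¹ := by
  rw [Complex.inv_def, Complex.normSq_eq_norm_sq, norm_expj]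
  simp

lemma expj_injective : Function.Injective expj := fun _ _ h =>
  AddCircle.injective_toCircle Real.two_pi_pos.ne' (Circle.coe_injective h)

lemma continuous_expj : Continuous expj :=
  continuous_induced_dom.comp AddCircle.continuous_toCircle

lemma expj_zpow (ω : Freq) (n : ℤ) : expj ω ^ n = fourier n ω := by
  rw [fourier_apply, AddCircle.toCircle_zsmul, Circle.coe_zpow, expj]

lemma continuous_expj_zpow (n : ℤ) : Continuous fun ω => expj ω ^ n := by
  simp only [expj_zpow]
  exact (fourier n).continuous

lemma nontrivial_freq : Nontrivial Freq := by
  refine ⟨((Real.pi : ℝ) : Freq), 0, fun h => ?_⟩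
  obtain ⟨n, hn⟩ := (AddCircle.coe_eq_zero_iff _).1 h
  rw [zsmul_eq_mul, ← mul_assoc, mul_eq_right₀ Real.pi_ne_zero] at hn
  norm_cast at hn
  lia

instance nullSingletonClass_freqMeasure : NullSingletonClass freqMeasure := by
  have := nontrivial_freq
  infer_instance

/-- A nonzero polynomial has no zero at `e^{jω}`, for almost every `ω`. -/
lemma ae_eval_expj_ne_zero {p : ℂ[X]} (hp : p ≠ 0) : ∀ᵐ ω ∂freqMeasure, p.eval (expj ω) ≠ 0 := by
  have h := (finite_setOfPred_isRoot hp).preimage (f := expj) expj_injective.injOn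
  simpa [ae_iff] using h.measure_zero freqMeasure

/-! ### Markov parameters and closure properties of `H_∞` -/

lemma markov_eq_integral {ι : Type} [Fintype ι] (f : Freq → EuclideanSpace ℂ ι) (t : ℤ) :
    markov f t = ∫ ω, expj ω ^ t • f ω ∂freqMeasure := by
  simp only [markov, fourierCoeff, expj_zpow, neg_neg]

variable {ι : Type} [Fintype ι] {f g : Freq → EuclideanSpace ℂ ι}

lemma aestronglyMeasurable_expj_zpow (n : ℤ) :
    AEStronglyMeasurable (fun ω => expj ω ^ n) freqMeasure :=
  (continuous_expj_zpow n).aestronglyMeasurable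

lemma memLp_zpow_smul {E : Type*} [NormedAddCommGroup E] [NormedSpace ℂ E] {f : Freq → E}
    {p : ENNReal} (hf : MemLp f p freqMeasure) (n : ℤ) :
    MemLp (fun ω => expj ω ^ n • f ω) p freqMeasure :=
  hf.of_le ((aestronglyMeasurable_expj_zpow n).smul hf.1)
    (ae_of_all _ fun ω => by simp [norm_smul, norm_expj])

lemma markov_apply (hf : MemLp f ⊤ freqMeasure) (t : ℤ) (i : ι) :
    markov f t i = ∫ ω, expj ω ^ t * f ω i ∂freqMeasure := by
  rw [markov_eq_integral]
  exact ((EuclideanSpace.proj (𝕜 := ℂ) i).integral_comp_comm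
    ((memLp_zpow_smul hf t).integrable le_top)).symm

lemma markov_add (hf : MemLp f ⊤ freqMeasure) (hg : MemLp g ⊤ freqMeasure) (t : ℤ) :
    markov (fun ω => f ω + g ω) t = markov f t + markov g t := by
  simp only [markov_eq_integral, smul_add]
  exact integral_add ((memLp_zpow_smul hf t).integrable le_top)
    ((memLp_zpow_smul hg t).integrable le_top)

lemma markov_const_smul (c : ℂ) (t : ℤ) : markov (fun ω => c • f ω) t = c • markov f t :=
  fourierCoeff.const_smul f c _

lemma markov_zpow_smul (k t : ℤ) : markov (fun ω => expj ω ^ k • f ω) t = markov f (t + k) := by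
  simp only [markov_eq_integral, smul_smul, zpow_add₀ (expj_ne_zero _)]

lemma IsHInf.add (hf : IsHInf f) (hg : IsHInf g) : IsHInf fun ω => f ω + g ω where
  memLp := hf.memLp.add hg.memLp
  causal t ht := by rw [markov_add hf.memLp hg.memLp, hf.causal t ht, hg.causal t ht, add_zero]
  real t i := by
    rw [markov_add hf.memLp hg.memLp, PiLp.add_apply, Complex.add_im, hf.real, hg.real, add_zero]

lemma IsHInf.const_smul (hf : IsHInf f) (c : ℝ) : IsHInf fun ω => (c : ℂ) • f ω where
  memLp := hf.memLp.const_smul (c : ℂ)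
  causal t ht := by rw [markov_const_smul, hf.causal t ht, smul_zero]
  real t i := by
    rw [markov_const_smul, PiLp.smul_apply, smul_eq_mul, Complex.im_ofReal_mul, hf.real, mul_zero]

lemma IsHInf.delay (hf : IsHInf f) (n : ℕ) : IsHInf fun ω => (expj ω)⁻¹ ^ n • f ω := by
  have h : (fun ω => (expj ω)⁻¹ ^ n • f ω) = fun ω => expj ω ^ (-n : ℤ) • f ω := by
    funext ω
    rw [zpow_neg, inv_pow, zpow_natCast]
  rw [h]
  refine ⟨memLp_zpow_smul hf.memLp _, fun t ht => ?_, fun t i => ?_⟩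
  · rw [markov_zpow_smul, hf.causal _ (by lia)]
  · rw [markov_zpow_smul, hf.real]

/-- Filtering by a real polynomial in the delay `e^{-jω}` preserves `H_∞`. -/
lemma IsHInf.filter (hf : IsHInf f) (q : ℝ[X]) : IsHInf fun ω => aeval (expj ω)⁻¹ q • f ω := by
  induction q using Polynomial.induction_on' with
  | add p q hp hq => simpa only [map_add, add_smul] using hp.add hq
  | monomial n c =>
    simpa only [aeval_monomial, mul_smul, Complex.coe_algebraMap] using (hf.delay n).const_smul c

/-! ### Rational symbols on the circle -/

namespace IsRational

lemma congr {f g : Freq → ℂ} (hf : IsRational f) (h : f =ᵐ[freqMeasure] g) : IsRational g := by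
  obtain ⟨p, q, hq, e⟩ := hf
  exact ⟨p, q, hq, h.symm.trans e⟩

lemma eval (p : ℂ[X]) : IsRational fun ω => p.eval (expj ω) :=
  ⟨p, 1, one_ne_zero, by simp⟩

lemma const (c : ℂ) : IsRational fun _ => c := by
  simpa using eval (C c)

lemma expj : IsRational expj := by
  simpa using eval X

lemma add {f g : Freq → ℂ} (hf : IsRational f) (hg : IsRational g) :
    IsRational fun ω => f ω + g ω := by
  obtain ⟨p, q, hq, e⟩ := hf
  obtain ⟨p', q', hq', e'⟩ := hg
  refine ⟨p * q' + q * p', q * q', mul_ne_zero hq hq', ?_⟩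
  filter_upwards [e, e', ae_eval_expj_ne_zero hq, ae_eval_expj_ne_zero hq'] with ω h h' h1 h2
  rw [h, h', div_add_div _ _ h1 h2]
  simp

lemma mul {f g : Freq → ℂ} (hf : IsRational f) (hg : IsRational g) :
    IsRational fun ω => f ω * g ω := by
  obtain ⟨p, q, hq, e⟩ := hf
  obtain ⟨p', q', hq', e'⟩ := hg
  refine ⟨p * p', q * q', mul_ne_zero hq hq', ?_⟩
  filter_upwards [e, e'] with ω h h'
  rw [h, h', div_mul_div_comm]
  simp

lemma neg {f : Freq → ℂ} (hf : IsRational f) : IsRational fun ω => -f ω := by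
  simpa using (const (-1)).mul hf

lemma sub {f g : Freq → ℂ} (hf : IsRational f) (hg : IsRational g) :
    IsRational fun ω => f ω - g ω := by
  simpa only [sub_eq_add_neg] using hf.add hg.neg

lemma inv {f : Freq → ℂ} (hf : IsRational f) : IsRational fun ω => (f ω)⁻¹ := by
  obtain ⟨p, q, hq, e⟩ := hf
  by_cases hp : p = 0
  · refine ⟨0, 1, one_ne_zero, ?_⟩
    filter_upwards [e] with ω h
    simp [h, hp]
  · refine ⟨q, p, hp, ?_⟩
    filter_upwards [e] with ω h
    simp [h]

lemma div {f g : Freq → ℂ} (hf : IsRational f) (hg : IsRational g) :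
    IsRational fun ω => f ω / g ω := by
  simpa only [div_eq_mul_inv] using hf.mul hg.inv

lemma sum {α : Type*} (s : Finset α) {f : α → Freq → ℂ} (hf : ∀ a ∈ s, IsRational (f a)) :
    IsRational fun ω => ∑ a ∈ s, f a ω := by
  induction s using Finset.cons_induction with
  | empty => simpa using const 0
  | cons a s ha ih =>
    simp only [Finset.sum_cons]
    exact (hf a (by simp)).add (ih fun b hb => hf b (by simp [hb]))

lemma prod {α : Type*} (s : Finset α) {f : α → Freq → ℂ} (hf : ∀ a ∈ s, IsRational (f a)) :
    IsRational fun ω => ∏ a ∈ s, f a ω := by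
  induction s using Finset.cons_induction with
  | empty => simpa using const 1
  | cons a s ha ih =>
    simp only [Finset.prod_cons]
    exact (hf a (by simp)).mul (ih fun b hb => hf b (by simp [hb]))

lemma pow {f : Freq → ℂ} (hf : IsRational f) (n : ℕ) : IsRational fun ω => f ω ^ n := by
  simpa using prod (Finset.range n) fun _ _ => hf

/-- On the circle the conjugate of `e^{jω}` is its inverse, so conjugation stays within rational
functions. This is what makes squared norms rational. -/
lemma star_eval (p : ℂ[X]) : IsRational fun ω => star (p.eval (MixedControl.expj ω)) := by
  simp only [eval_eq_sum_range, star_sum, star_mul', star_pow, conj_expj]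
  exact sum _ fun n _ => (const _).mul (expj.inv.pow n)

lemma star {f : Freq → ℂ} (hf : IsRational f) : IsRational fun ω => star (f ω) := by
  obtain ⟨p, q, hq, e⟩ := hf
  refine ((star_eval p).div (star_eval q)).congr ?_
  filter_upwards [e] with ω h
  simp [h]

lemma norm_sq {f : Freq → ℂ} (hf : IsRational f) : IsRational fun ω => ((‖f ω‖ ^ 2 : ℝ) : ℂ) := by
  simpa [Complex.conj_mul'] using hf.star.mul hf

lemma det {n : Type*} [Fintype n] [DecidableEq n] {M : Freq → Matrix n n ℂ}
    (hM : ∀ i j, IsRational fun ω => M ω i j) : IsRational fun ω => (M ω).det := by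
  simp only [Matrix.det_apply']
  exact sum _ fun σ _ => (const _).mul (prod _ fun i _ => hM _ _)

/-- Cramer's rule. An identically vanishing determinant is harmless, since the inverse is then zero
by convention. -/
lemma matrix_inv {n : Type*} [Fintype n] [DecidableEq n] {M : Freq → Matrix n n ℂ}
    (hM : ∀ i j, IsRational fun ω => M ω i j) (i j : n) : IsRational fun ω => (M ω)⁻¹ i j := by
  simp only [Matrix.inv_def, Ring.inverse_eq_inv', Matrix.smul_apply, smul_eq_mul,
    Matrix.adjugate_apply]
  refine (det hM).inv.mul (det fun k l => ?_)
  by_cases hk : k = j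
  · subst hk
    simpa using const _
  · simpa [Matrix.updateRow_ne hk] using hM k l

end IsRational

namespace LTISystem

variable {dx du : ℕ} (S : LTISystem dx du)

lemma isRational_resolvent (A : Matrix (Fin dx) (Fin dx) ℂ) (i j : Fin dx) :
    IsRational fun ω => (expj ω • (1 : Matrix (Fin dx) (Fin dx) ℂ) - A)⁻¹ i j := by
  refine IsRational.matrix_inv (fun k l => ?_) i j
  simp only [Matrix.sub_apply, Matrix.smul_apply, smul_eq_mul]
  exact (IsRational.expj.mul (.const _)).sub (.const _)

lemma isRational_F (i : Fin dx) (j : Fin du) : IsRational fun ω => S.F ω i j := by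
  simp only [F, Matrix.mul_apply]
  exact .sum _ fun k _ => (isRational_resolvent _ i k).mul (.const _)

lemma isRational_G (i : Fin dx) (j : Fin 1) : IsRational fun ω => S.G ω i j := by
  simp only [G, Matrix.mul_apply]
  exact .sum _ fun k _ => (isRational_resolvent _ i k).mul (.const _)

lemma isRational_norm_sq_closedLoop {K : Freq → EuclideanSpace ℂ (Fin du)}
    (hK : IsRationalVec K) : IsRational fun ω => ((‖S.closedLoop K ω‖ ^ 2 : ℝ) : ℂ) := by
  simp only [EuclideanSpace.norm_sq_eq, Complex.ofReal_sum]
  refine .sum _ fun i _ => .norm_sq ?_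
  rcases i with i | i
  · simp only [closedLoop, Sum.elim_inl, Matrix.mulVec, dotProduct]
    exact (IsRational.sum _ fun j _ => (S.isRational_F i j).mul (hK j)).add (S.isRational_G i 0)
  · exact hK i

end LTISystem

/-! ### Fourier coefficients and finite-dimensional realizations -/

/-- A square-integrable scalar symbol is determined by its Fourier coefficients. -/
lemma ae_eq_zero_of_fourierCoeff {f : Freq → ℂ} (hf : MemLp f 2 freqMeasure)
    (h : ∀ n, fourierCoeff f n = 0) : f =ᵐ[freqMeasure] 0 := by
  have h0 : fourierBasis.repr hf.toLp = 0 := by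
    ext n
    rw [fourierBasis_repr, fourierCoeff_congr_ae hf.coeFn_toLp, h]
    rfl
  rw [map_eq_zero_iff _ fourierBasis.repr.injective] at h0
  exact hf.coeFn_toLp.symm.trans (h0 ▸ Lp.coeFn_zero _ _ _)

/-- By Parseval the squared coefficients are summable. -/
lemma tendsto_fourierCoeff {f : Freq → ℂ} (hf : MemLp f 2 freqMeasure) :
    Tendsto (fourierCoeff f) cofinite (𝓝 0) := by
  have h := (hasSum_sq_fourierCoeff hf.toLp).summable.tendsto_cofinite_zero
  simp only [fourierCoeff_congr_ae hf.coeFn_toLp] at h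
  rw [tendsto_zero_iff_norm_tendsto_zero]
  simpa using h.sqrt

lemma integral_expj_zpow (n : ℤ) : ∫ ω, expj ω ^ n ∂freqMeasure = if n = 0 then 1 else 0 := by
  have h := fourierCoeff_fourier (T := 2 * Real.pi) n
  have h0 := congrFun h 0
  simp only [fourierCoeff, neg_zero, fourier_zero, one_smul, ← expj_zpow] at h0
  rw [h0, Pi.single_apply]
  simp [eq_comm]

/-- A square-integrable scalar symbol with finitely many nonzero Fourier coefficients, all at
nonnegative powers of `e^{jω}`, is a polynomial. -/
lemma ae_eq_eval_of_integral_eq_zero {f : Freq → ℂ} (hf : MemLp f 2 freqMeasure) (n : ℕ)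
    (h : ∀ t : ℤ, (∀ k ∈ Finset.range (n + 1), t ≠ -(k : ℤ)) →
      ∫ ω, expj ω ^ t * f ω ∂freqMeasure = 0) :
    ∃ p : ℂ[X], f =ᵐ[freqMeasure] fun ω => p.eval (expj ω) := by
  let c : ℕ → ℂ := fun k => ∫ ω, expj ω ^ (-k : ℤ) * f ω ∂freqMeasure
  refine ⟨∑ k ∈ Finset.range (n + 1), C (c k) * X ^ k, ?_⟩
  have hp : MemLp (fun ω => ∑ k ∈ Finset.range (n + 1), c k * expj ω ^ k) 2 freqMeasure :=
    memLp_finsetSum _ fun k _ => by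
      have := (memLp_zpow_smul (memLp_const (μ := freqMeasure) (p := 2) (c k)) k)
      simpa [mul_comm] using this
  have hz := ae_eq_zero_of_fourierCoeff (hf.sub hp) fun m => ?_
  · filter_upwards [hz] with ω hω
    simpa [eval_finsetSum, sub_eq_zero] using hω
  have hi (g : Freq → ℂ) (hg : MemLp g 2 freqMeasure) :
      Integrable (fun ω => expj ω ^ (-m) * g ω) freqMeasure :=
    (memLp_zpow_smul hg (-m)).integrable one_le_two
  simp only [fourierCoeff, ← expj_zpow, Pi.sub_apply, smul_eq_mul, mul_sub]
  rw [integral_sub (hi _ hf) (hi _ hp), sub_eq_zero]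
  have hs : ∫ ω, expj ω ^ (-m) * ∑ k ∈ Finset.range (n + 1), c k * expj ω ^ k ∂freqMeasure
      = ∑ k ∈ Finset.range (n + 1), if -m + k = 0 then c k else 0 := by
    have : ∀ ω, expj ω ^ (-m) * ∑ k ∈ Finset.range (n + 1), c k * expj ω ^ k
        = ∑ k ∈ Finset.range (n + 1), c k * expj ω ^ (-m + k) := fun ω => by
      rw [Finset.mul_sum]
      refine Finset.sum_congr rfl fun k _ => ?_
      rw [zpow_add₀ (expj_ne_zero ω), zpow_natCast]
      ring
    simp only [this]
    rw [integral_finsetSum]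
    · refine Finset.sum_congr rfl fun k _ => ?_
      rw [integral_const_mul, integral_expj_zpow]
      simp
    · exact fun k _ => ((continuous_const.mul (continuous_expj_zpow _)).memLp_of_hasCompactSupport
        (p := 1) (HasCompactSupport.of_compactSpace _)).integrable le_rfl
  rw [hs]
  by_cases hm : ∃ k ∈ Finset.range (n + 1), -m = -(k : ℤ)
  · obtain ⟨k, hk, e⟩ := hm
    rw [Finset.sum_eq_single_of_mem k hk fun l _ hl => if_neg (by lia), if_pos (by lia), e]
  · push Not at hm
    rw [h _ hm, Finset.sum_eq_zero fun k hk => if_neg fun e => hm k hk (by lia)]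

/-- A bounded causal symbol with a finite-dimensional realization is rational. -/
lemma isRationalVec_of_hasStateSpaceRealization {m : ℕ} {K : Freq → EuclideanSpace ℂ (Fin m)}
    (hK : IsHInf K) (h : HasStateSpaceRealization K) : IsRationalVec K := by
  obtain ⟨n, a, b, c, d, -, h⟩ := h
  intro i
  have hb : MemLp (fun ω => K ω i) 2 freqMeasure :=
    ((EuclideanSpace.proj (𝕜 := ℂ) i).comp_memLp' hK.memLp).mono_exponent le_top
  have hchi : a.charpoly ≠ 0 := a.charpoly_monic.ne_zero
  have hsum : ∀ ω, a.charpoly.eval (expj ω) * K ω i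
      = ∑ k ∈ Finset.range (n + 1), a.charpoly.coeff k * (expj ω ^ (k : ℤ) * K ω i) := fun ω => by
    rw [eval_eq_sum_range, Matrix.charpoly_natDegree_eq_dim, Fintype.card_fin, Finset.sum_mul]
    simp [mul_assoc]
  have hf : MemLp (fun ω => a.charpoly.eval (expj ω) * K ω i) 2 freqMeasure := by
    simp only [hsum]
    exact memLp_finsetSum _ fun k _ => (memLp_zpow_smul hb k).const_mul _
  -- The product `χ_a(e^{jω}) K_i` has Markov parameters `∑ k, χ_k K_{t+k}`. They vanish for `t > 0`
  -- by Cayley–Hamilton and for `t < -n` by causality. The value `t = 0`, where `d` enters, is among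
  -- the allowed exceptions.
  have hpoly := ae_eq_eval_of_integral_eq_zero hf n fun t ht => ?_
  · obtain ⟨p, hp⟩ := hpoly
    refine ⟨p, a.charpoly, hchi, ?_⟩
    filter_upwards [hp, ae_eval_expj_ne_zero hchi] with ω h1 h2
    rw [eq_div_iff h2, mul_comm, h1]
  have hmar : ∫ ω, expj ω ^ t * (a.charpoly.eval (expj ω) * K ω i) ∂freqMeasure
      = ∑ k ∈ Finset.range (n + 1), a.charpoly.coeff k * markov K (t + k) i := by
    simp only [hsum, Finset.mul_sum, markov_apply hK.memLp]
    rw [integral_finsetSum]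
    · refine Finset.sum_congr rfl fun k _ => ?_
      rw [← integral_const_mul]
      congr with ω
      rw [zpow_add₀ (expj_ne_zero ω)]
      ring
    · exact fun k _ => (memLp_zpow_smul ((memLp_zpow_smul hb k).const_mul _) t).integrable one_le_two
  rw [hmar]
  rcases lt_or_ge 0 t with h0 | h0
  · obtain ⟨s, rfl⟩ : ∃ s : ℕ, t = s + 1 := ⟨(t - 1).toNat, by lia⟩
    have hk : ∀ k : ℕ, markov K ((s : ℤ) + 1 + k) i
        = (c.mulVec ((a ^ k * a ^ s).mulVec b)) i := fun k => by
      rw [← pow_add, ← h, show (s : ℤ) + 1 + k = ((k + s : ℕ) : ℤ) + 1 by push_cast; ring]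
    simp only [hk]
    have hch := Matrix.aeval_self_charpoly a
    rw [aeval_eq_sum_range, Matrix.charpoly_natDegree_eq_dim, Fintype.card_fin] at hch
    have := congrArg (fun M => (c.mulVec ((M * a ^ s).mulVec b)) i) hch
    simpa [Finset.sum_mul, Matrix.sum_mulVec, Matrix.mulVec_sum, Matrix.smul_mulVec,
      Matrix.mulVec_smul] using this
  · refine Finset.sum_eq_zero fun k hk => ?_
    have : t + k < 0 := by
      by_contra hlt
      have hn := Finset.mem_range.1 hk
      exact ht (-t).toNat (Finset.mem_range.2 (by lia)) (by lia)
    rw [hK.causal _ this]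
    simp

/-! ### Decaying functionals and unimodular roots -/

/-- A linear functional on polynomials whose moments tend to zero and which annihilates all
multiples of a product of linear factors with unimodular roots is zero. -/
lemma functional_eq_zero_of_unimodular_multiples (ℓ : ℂ[X] →ₗ[ℂ] ℂ)
    (h0 : Tendsto (fun n : ℕ => ℓ (X ^ n)) atTop (𝓝 0)) (M : Multiset ℂ) (hM : ∀ α ∈ M, ‖α‖ = 1)
    (hℓ : ∀ R, ℓ ((M.map fun α => X - C α).prod * R) = 0) (R : ℂ[X]) : ℓ R = 0 := by
  have htend : ∀ P : ℂ[X], Tendsto (fun n : ℕ => ℓ (X ^ n * P)) atTop (𝓝 0) := fun P => by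
    induction P using Polynomial.induction_on' with
    | add p q hp hq => simpa [mul_add] using hp.add hq
    | monomial k c =>
      have h := ((tendsto_add_atTop_iff_nat k).2 h0).const_mul c
      rw [mul_zero] at h
      refine h.congr fun n => ?_
      rw [← C_mul_X_pow_eq_monomial, mul_left_comm, ← pow_add, ← smul_eq_C_mul, map_smul,
        smul_eq_mul]
  induction M using Multiset.induction_on generalizing R with
  | empty => simpa using hℓ R
  | cons α M ih =>
    refine ih (fun β hβ => hM β (Multiset.mem_cons_of_mem hβ)) (fun R => ?_) R
    set Q := (M.map fun α => X - C α).prod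
    have hα := hM α (Multiset.mem_cons_self _ _)
    -- Since `X - α` divides `X^n - α^n`, multiplication by `X^n` acts as `α^n`. The modulus is then
    -- constant in `n` and tends to zero, so the factor `X - α` can be dropped.
    have hn : ∀ n : ℕ, ℓ (X ^ n * (Q * R)) = α ^ n * ℓ (Q * R) := fun n => by
      obtain ⟨D, hD⟩ := sub_dvd_pow_sub_pow (X : ℂ[X]) (C α) n
      have h := hℓ (D * R)
      rw [Multiset.map_cons, Multiset.prod_cons,
        show (X - C α) * Q * (D * R) = (X - C α) * D * (Q * R) by ring, ← hD, sub_mul, map_sub,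
        sub_eq_zero] at h
      rw [h, ← C_pow, ← smul_eq_C_mul, map_smul, smul_eq_mul]
    have h := (htend (Q * R)).norm
    simp only [hn, norm_mul, norm_pow, hα, one_pow, one_mul, norm_zero] at h
    exact norm_eq_zero.1 (tendsto_nhds_unique tendsto_const_nhds h)

/-- A nonzero polynomial is bounded below on the circle by a product of linear factors with
unimodular roots. -/
lemma exists_unimodular_lower_bound {p : ℂ[X]} (hp : p ≠ 0) :
    ∃ (M : Multiset ℂ) (c : ℝ), 0 < c ∧ (∀ α ∈ M, ‖α‖ = 1) ∧
      ∀ z : ℂ, ‖z‖ = 1 → c * (M.map fun α => ‖z - α‖).prod ≤ ‖p.eval z‖ := by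
  have key : ∀ N : Multiset ℂ, ∃ (M : Multiset ℂ) (c : ℝ), 0 < c ∧ (∀ α ∈ M, ‖α‖ = 1) ∧
      ∀ z : ℂ, ‖z‖ = 1 →
        c * (M.map fun α => ‖z - α‖).prod ≤ (N.map fun α => ‖z - α‖).prod := fun N => by
    induction N using Multiset.induction_on with
    | empty => exact ⟨0, 1, one_pos, by simp, by simp⟩
    | cons β N ih =>
      obtain ⟨M, c, hc, hM, h⟩ := ih
      by_cases hβ : ‖β‖ = 1
      · refine ⟨β ::ₘ M, c, hc, by simpa [hβ] using hM, fun z hz => ?_⟩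
        simp only [Multiset.map_cons, Multiset.prod_cons]
        rw [mul_left_comm]
        exact mul_le_mul_of_nonneg_left (h z hz) (norm_nonneg _)
      -- A root off the circle stays at distance at least `|1 - ‖β‖|` from it and is absorbed into
      -- the constant.
      · refine ⟨M, |1 - ‖β‖| * c, mul_pos (abs_pos.2 (sub_ne_zero.2 (Ne.symm hβ))) hc, hM,
          fun z hz => ?_⟩
        simp only [Multiset.map_cons, Multiset.prod_cons]
        rw [mul_assoc]
        refine mul_le_mul (hz ▸ abs_norm_sub_norm_le z β) (h z hz) ?_ (norm_nonneg _)
        exact mul_nonneg hc.le (Multiset.prod_nonneg (by simp))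
  obtain ⟨M, c, hc, hM, h⟩ := key p.roots
  refine ⟨M, ‖p.leadingCoeff‖ * c, mul_pos (by simpa using hp) hc, hM, fun z hz => ?_⟩
  have hs := (IsAlgClosed.splits p).eval_eq_prod_roots z
  have hn : ‖(p.roots.map fun α => z - α).prod‖ = (p.roots.map fun α => ‖z - α‖).prod := by
    have := map_multiset_prod (normHom : ℂ →*₀ ℝ) (p.roots.map fun α => z - α)
    simpa [Multiset.map_map, Function.comp_def] using this
  rw [hs, norm_mul, mul_assoc, hn]
  exact mul_le_mul_of_nonneg_left (h z hz) (norm_nonneg _)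

/-- The real polynomial `∏ (X - α) (X - ᾱ)`. -/
def conjProd (M : Multiset ℂ) : ℝ[X] :=
  (M.map fun α => X ^ 2 - C (2 * α.re) * X + C (‖α‖ ^ 2)).prod

/-- Filters must have real coefficients to keep the Markov parameters real. Over `ℂ` they split with
roots `α` and `ᾱ`, again unimodular when `M` is, so the complex lemma applies. -/
lemma map_conjProd (M : Multiset ℂ) : (conjProd M).map (algebraMap ℝ ℂ)
    = ((M + M.map (starRingEnd ℂ)).map fun α => X - C α).prod := by
  induction M using Multiset.induction_on with
  | empty => simp [conjProd]
  | cons α M ih =>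
    have h1 : conjProd (α ::ₘ M)
        = (X ^ 2 - C (2 * α.re) * X + C (‖α‖ ^ 2)) * conjProd M := by simp [conjProd]
    have h2 : (((α ::ₘ M) + (α ::ₘ M).map (starRingEnd ℂ)).map fun α => (X : ℂ[X]) - C α).prod
        = ((X - C α) * (X - C (starRingEnd ℂ α))) *
          ((M + M.map (starRingEnd ℂ)).map fun α => X - C α).prod := by
      simp only [Multiset.map_cons, Multiset.map_add, Multiset.prod_add, Multiset.prod_cons]
      ring
    have h3 : (C ((‖α‖ ^ 2 : ℝ) : ℂ) : ℂ[X]) = C α * C (starRingEnd ℂ α) := by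
      rw [← C_mul, Complex.mul_conj']
      simp
    have h4 : (C ((2 * α.re : ℝ) : ℂ) : ℂ[X]) = C α + C (starRingEnd ℂ α) := by
      rw [← C_add, Complex.add_conj]
    rw [h1, h2, ← ih, Polynomial.map_mul]
    congr 1
    simp only [Polynomial.map_add, Polynomial.map_sub, Polynomial.map_mul, Polynomial.map_pow,
      map_X, map_C, Complex.coe_algebraMap, h3, h4]
    ring

/-- For `|z| = 1`, `z⁻¹ = z̄`, so the quadratic factor at `z⁻¹` is `(z⁻¹ - α)` times the conjugate
of `z - α`. The first has modulus at most 2, the second `|z - α|`. -/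
lemma norm_aeval_conjProd_le (M : Multiset ℂ) (hM : ∀ α ∈ M, ‖α‖ = 1) {z : ℂ} (hz : ‖z‖ = 1) :
    ‖aeval z⁻¹ (conjProd M)‖ ≤ 2 ^ M.card * (M.map fun α => ‖z - α‖).prod := by
  induction M using Multiset.induction_on with
  | empty => simp [conjProd]
  | cons α M ih =>
    have h1 : conjProd (α ::ₘ M)
        = (X ^ 2 - C (2 * α.re) * X + C (‖α‖ ^ 2)) * conjProd M := by simp [conjProd]
    have hα := hM α (Multiset.mem_cons_self _ _)
    have hzi : z⁻¹ = starRingEnd ℂ z := by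
      rw [Complex.inv_def, Complex.normSq_eq_norm_sq, hz]
      simp
    have h2 : aeval z⁻¹ (X ^ 2 - C (2 * α.re) * X + C (‖α‖ ^ 2) : ℝ[X])
        = (z⁻¹ - α) * starRingEnd ℂ (z - α) := by
      have h3 := Complex.mul_conj' α
      have h4 := Complex.add_conj α
      simp only [map_add, map_sub, map_mul, map_pow, aeval_X, aeval_C, Complex.coe_algebraMap]
      push_cast at h4 ⊢
      rw [← hzi]
      linear_combination z⁻¹ * h4 - h3
    have h5 : ‖z⁻¹ - α‖ ≤ 2 := (norm_sub_le _ _).trans (by rw [norm_inv, hz, hα]; norm_num)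
    rw [h1, map_mul, norm_mul, h2, norm_mul, RCLike.norm_conj, Multiset.map_cons,
      Multiset.prod_cons, Multiset.card_cons, pow_succ]
    have h6 := ih fun β hβ => hM β (Multiset.mem_cons_of_mem hβ)
    calc ‖z⁻¹ - α‖ * ‖z - α‖ * ‖aeval z⁻¹ (conjProd M)‖
        ≤ 2 * ‖z - α‖ * (2 ^ M.card * (M.map fun α => ‖z - α‖).prod) := by gcongr
      _ = _ := by ring

/-- A real functional on real polynomials whose moments tend to zero and which annihilates all
shifts of `conjProd M`, with `M` on the unit circle, is zero. -/
lemma real_functional_eq_zero (a : ℕ → ℝ) (h0 : Tendsto a atTop (𝓝 0)) (M : Multiset ℂ)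
    (hM : ∀ α ∈ M, ‖α‖ = 1) (ℓ : ℝ[X] →ₗ[ℝ] ℝ) (ha : ∀ n, ℓ (X ^ n) = a n)
    (hℓ : ∀ n : ℕ, ℓ (conjProd M * X ^ n) = 0) : ℓ 1 = 0 := by
  -- The complex-linear extension of `ℓ`, determined by the same moments.
  let L : ℂ[X] →ₗ[ℂ] ℂ := Polynomial.lsum fun n => (a n : ℂ) • LinearMap.id
  have hL : ∀ (n : ℕ) (c : ℂ), L (monomial n c) = c * a n := fun n c => by
    simp [L, Polynomial.lsum_apply, mul_comm]
  have hmap : ∀ q : ℝ[X], L (q.map (algebraMap ℝ ℂ)) = ℓ q := fun q => by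
    induction q using Polynomial.induction_on' with
    | add p q hp hq => simp [hp, hq]
    | monomial n c =>
      rw [map_monomial, hL, ← C_mul_X_pow_eq_monomial, ← smul_eq_C_mul, map_smul, ha]
      simp
  have h := functional_eq_zero_of_unimodular_multiples L ?_ (M + M.map (starRingEnd ℂ)) ?_ ?_ 1
  · have h1 := hmap 1
    rw [Polynomial.map_one, h] at h1
    exact_mod_cast h1.symm
  · have : ∀ n : ℕ, L (X ^ n) = (a n : ℂ) := fun n => by
      rw [X_pow_eq_monomial, hL, one_mul]
    simp only [this]
    exact_mod_cast (Complex.continuous_ofReal.tendsto 0).comp h0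
  · intro α hα
    rcases Multiset.mem_add.1 hα with hα | hα
    · exact hM α hα
    · obtain ⟨β, hβ, rfl⟩ := Multiset.mem_map.1 hα
      rw [RCLike.norm_conj, hM β hβ]
  · intro R
    rw [← map_conjProd]
    induction R using Polynomial.induction_on' with
    | add p q hp hq => rw [mul_add, map_add, hp, hq, add_zero]
    | monomial n c =>
      have h1 := hmap (conjProd M * X ^ n)
      rw [hℓ, Polynomial.map_mul, Polynomial.map_pow, map_X] at h1
      rw [← C_mul_X_pow_eq_monomial, mul_left_comm, ← smul_eq_C_mul, map_smul, h1]
      simp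

/-! ### Limits in `H_∞` -/

section
variable {ι : Type} [Fintype ι]

lemma IsHInf.sub {f g : Freq → EuclideanSpace ℂ ι} (hf : IsHInf f) (hg : IsHInf g) :
    IsHInf fun ω => f ω - g ω := by
  simpa [sub_eq_add_neg] using hf.add (hg.const_smul (-1))

/-- Uniformly bounded pointwise limits of `H_∞` symbols are in `H_∞`. -/
lemma IsHInf.of_tendsto {f : ℕ → Freq → EuclideanSpace ℂ ι} {g : Freq → EuclideanSpace ℂ ι}
    {γ : ℝ} (hf : ∀ n, IsHInf (f n)) (hγ : ∀ n, ∀ᵐ ω ∂freqMeasure, ‖f n ω‖ ≤ γ)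
    (hg : ∀ᵐ ω ∂freqMeasure, Tendsto (fun n => f n ω) atTop (𝓝 (g ω))) : IsHInf g := by
  have hm : MemLp g ⊤ freqMeasure := by
    refine memLp_top_of_bound (aestronglyMeasurable_of_tendsto_ae atTop
      (fun n => (hf n).memLp.1) hg) γ ?_
    filter_upwards [hg, ae_all_iff.2 hγ] with ω h1 h2
    exact le_of_tendsto h1.norm (Eventually.of_forall h2)
  have hlim : ∀ t i, Tendsto (fun n => markov (f n) t i) atTop (𝓝 (markov g t i)) := fun t i => by
    simp only [markov_apply (hf _).memLp, markov_apply hm]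
    refine tendsto_integral_of_dominated_convergence (fun _ => γ) (fun n => ?_)
      (integrable_const γ) (fun n => ?_) ?_
    · exact (memLp_zpow_smul
        ((EuclideanSpace.proj (𝕜 := ℂ) i).comp_memLp' (hf n).memLp) t).1
    · filter_upwards [hγ n] with ω h
      rw [norm_mul, norm_zpow, norm_expj, one_zpow, one_mul]
      exact (PiLp.norm_apply_le _ _).trans h
    · filter_upwards [hg] with ω h
      exact (((EuclideanSpace.proj (𝕜 := ℂ) i).continuous.tendsto _).comp h).const_mul _
  refine ⟨hm, fun t ht => ?_, fun t i => ?_⟩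
  · ext i
    have h := hlim t i
    simp only [fun n => (hf n).causal t ht] at h
    exact tendsto_nhds_unique h tendsto_const_nhds
  · have h := (Complex.continuous_im.tendsto _).comp (hlim t i)
    simp only [Function.comp_def, (hf _).real] at h
    exact tendsto_nhds_unique h tendsto_const_nhds

end

/-! ### Feasibility, existence and uniqueness -/

namespace LTISystem

variable {dx du : ℕ} (S : LTISystem dx du) {K K' : Freq → EuclideanSpace ℂ (Fin du)} {γ : ℝ}

/-- `T_K` is affine in `K`, so `G` cancels in differences, and a scalar filter commutes with `F`. -/
lemma closedLoop_filter (c : Freq → ℂ) (ω : Freq) :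
    S.closedLoop (fun ω => K ω + c ω • (K' ω - K ω)) ω
      = S.closedLoop K ω + c ω • (S.closedLoop K' ω - S.closedLoop K ω) := by
  ext i
  rcases i with i | i
  · simp [closedLoop, Matrix.mulVec_add, Matrix.mulVec_smul, Matrix.mulVec_sub]
    ring
  · simp [closedLoop]

variable {S}

/-- Moving from one admissible controller towards another through a real causal polynomial filter
yields an admissible controller. -/
lemma IsAdmissible.filter (hK : S.IsAdmissible K) (hK' : S.IsAdmissible K') (q : ℝ[X]) :
    S.IsAdmissible fun ω => K ω + aeval (expj ω)⁻¹ q • (K' ω - K ω) := by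
  refine ⟨hK.1.add ((hK'.1.sub hK.1).filter q), ?_⟩
  have h := hK.2.add ((hK'.2.sub hK.2).filter q)
  rwa [← funext fun ω => S.closedLoop_filter (fun ω => aeval (expj ω)⁻¹ q) ω] at h

lemma IsAdmissible.norm_le (hK : S.IsAdmissible K) :
    ∀ᵐ ω ∂freqMeasure, ‖S.closedLoop K ω‖ ≤ S.hInfNorm K := by
  filter_upwards [ae_le_eLpNormEssSup (f := S.closedLoop K) (μ := freqMeasure)] with ω h
  rw [hInfNorm, eLpNorm_exponent_top, ← toReal_enorm]
  exact ENNReal.toReal_mono (by simpa using hK.2.memLp.eLpNorm_ne_top) h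

lemma hInfNorm_le (hγ : 0 ≤ γ) (h : ∀ᵐ ω ∂freqMeasure, ‖S.closedLoop K ω‖ ≤ γ) :
    S.hInfNorm K ≤ γ := by
  rw [hInfNorm, eLpNorm_exponent_top]
  exact ENNReal.toReal_le_of_le_ofReal hγ (eLpNormEssSup_le_of_ae_bound h)

lemma hInfNorm_nonneg : 0 ≤ S.hInfNorm K := ENNReal.toReal_nonneg

lemma gammaInf_nonneg : 0 ≤ S.gammaInf := Real.sInf_nonneg <| by
  rintro _ ⟨K, -, rfl⟩
  exact hInfNorm_nonneg

lemma gammaTwo_le (hK : S.IsH2Optimal K) : S.gammaTwo ≤ S.hInfNorm K :=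
  csInf_le ⟨0, by rintro _ ⟨K, -, rfl⟩; exact hInfNorm_nonneg⟩ ⟨K, hK, rfl⟩

/-- Without admissible controllers both `γ_∞` and `γ_2` would be `sInf ∅ = 0`, leaving no room for
`γ`. -/
lemma exists_strictly_feasible (hγ : γ ∈ Set.Ioo S.gammaInf S.gammaTwo) :
    ∃ K, S.IsAdmissible K ∧ S.hInfNorm K < γ := by
  have hne : {K | S.IsAdmissible K}.Nonempty := by
    by_contra h
    rw [Set.not_nonempty_iff_eq_empty] at h
    have h2 : {K | S.IsH2Optimal K} = ∅ :=
      Set.subset_eq_empty (fun K hK => hK.1) h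
    have := hγ.1.trans hγ.2
    simp [gammaInf, gammaTwo, h, h2] at this
  obtain ⟨_, ⟨K, hK, rfl⟩, h⟩ := exists_lt_of_csInf_lt (hne.image _) hγ.1
  exact ⟨K, hK, h⟩

/-- Without an `H_2` optimum, `γ_2` would be `sInf ∅ = 0`, but `γ_2 > γ_∞ ≥ 0`. -/
lemma exists_isH2Optimal (hγ : γ ∈ Set.Ioo S.gammaInf S.gammaTwo) : ∃ K, S.IsH2Optimal K := by
  by_contra! h
  have h2 : {K | S.IsH2Optimal K} = ∅ := Set.eq_empty_of_forall_notMem h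
  have := gammaInf_nonneg.trans_lt (hγ.1.trans hγ.2)
  simp [gammaTwo, h2] at this

lemma IsAdmissible.integrable_norm_sq (hK : S.IsAdmissible K) :
    Integrable (fun ω => ‖S.closedLoop K ω‖ ^ 2) freqMeasure :=
  (hK.2.memLp.mono_exponent le_top).integrable_norm_pow (by norm_num)

lemma IsAdmissible.h2NormSq_le (hK : S.IsAdmissible K) : S.h2NormSq K ≤ S.hInfNorm K ^ 2 := by
  have h := integral_mono_ae hK.integrable_norm_sq (integrable_const (S.hInfNorm K ^ 2))
    (by filter_upwards [hK.norm_le] with ω h using by gcongr)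
  simpa [h2NormSq] using h

lemma h2NormSq_eq_of_ae (h : ∀ᵐ ω ∂freqMeasure, ‖S.closedLoop K ω‖ ^ 2 = γ ^ 2) :
    S.h2NormSq K = γ ^ 2 := by
  rw [h2NormSq, integral_congr_ae h]
  simp

lemma IsAdmissible.integrable_inner (hK : S.IsAdmissible K) (hK' : S.IsAdmissible K') :
    Integrable (fun ω => inner ℂ (S.closedLoop K ω) (S.closedLoop K' ω - S.closedLoop K ω))
      freqMeasure := by
  have h1 : MemLp (S.closedLoop K) 2 freqMeasure := hK.2.memLp.mono_exponent le_top
  have h2 : MemLp (fun ω => S.closedLoop K' ω - S.closedLoop K ω) 2 freqMeasure :=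
    (hK'.2.sub hK.2).memLp.mono_exponent le_top
  exact (L2.integrable_inner (𝕜 := ℂ) h1.toLp h2.toLp).congr
    (by filter_upwards [h1.coeFn_toLp, h2.coeFn_toLp] with ω e1 e2 using by rw [e1, e2])

/-- The mixed `H_2/H_∞` problem has a solution. -/
lemma exists_isMixedOptimal (hγ : ∃ K, S.IsAdmissible K ∧ S.hInfNorm K ≤ γ) :
    ∃ K, S.IsMixedOptimal γ K := by
  obtain ⟨K₀, hK₀, hK₀γ⟩ := hγ
  have hγ0 : 0 ≤ γ := hInfNorm_nonneg.trans hK₀γ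
  -- The feasible closed loops in `L_2`, where the cost is the squared norm; a minimizer is the
  -- point of `V` nearest to 0.
  let V : Set (Lp (EuclideanSpace ℂ (Fin dx ⊕ Fin du)) 2 freqMeasure) :=
    {f | ∃ K, S.IsAdmissible K ∧ S.hInfNorm K ≤ γ ∧ f =ᵐ[freqMeasure] S.closedLoop K}
  have hmem (K) (hK : S.IsAdmissible K) : MemLp (S.closedLoop K) 2 freqMeasure :=
    hK.2.memLp.mono_exponent le_top
  have hC (K) (hK : S.IsAdmissible K) (h : S.hInfNorm K ≤ γ) : (hmem K hK).toLp ∈ V :=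
    ⟨K, hK, h, MemLp.coeFn_toLp _⟩
  have hnorm (f : Lp (EuclideanSpace ℂ (Fin dx ⊕ Fin du)) 2 freqMeasure) (K)
      (hf : f =ᵐ[freqMeasure] S.closedLoop K) : ‖f‖ ^ 2 = S.h2NormSq K := by
    rw [← real_inner_self_eq_norm_sq, L2.inner_def, h2NormSq]
    refine integral_congr_ae ?_
    filter_upwards [hf] with ω e
    rw [real_inner_self_eq_norm_sq, e]
  have hconv : Convex ℝ V := by
    rintro f ⟨K, hK, hKγ, hf⟩ g ⟨K', hK', hK'γ, hg⟩ a b ha hb hab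
    have hcl : ∀ ω, S.closedLoop (fun ω => K ω + aeval (expj ω)⁻¹ (C b : ℝ[X]) • (K' ω - K ω)) ω
        = a • S.closedLoop K ω + b • S.closedLoop K' ω := fun ω => by
      rw [S.closedLoop_filter (fun ω => aeval (expj ω)⁻¹ (C b : ℝ[X])), aeval_C,
        algebraMap_smul, eq_sub_iff_add_eq.2 hab]
      module
    refine ⟨_, hK.filter hK' (C b), hInfNorm_le hγ0 ?_, ?_⟩
    · filter_upwards [hK.norm_le, hK'.norm_le] with ω h1 h2
      rw [hcl]
      calc _ ≤ ‖a • S.closedLoop K ω‖ + ‖b • S.closedLoop K' ω‖ := norm_add_le _ _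
        _ = a * ‖S.closedLoop K ω‖ + b * ‖S.closedLoop K' ω‖ := by
          rw [norm_smul, norm_smul, Real.norm_of_nonneg ha, Real.norm_of_nonneg hb]
        _ ≤ a * γ + b * γ := by gcongr <;> linarith
        _ = γ := by rw [← add_mul, hab, one_mul]
    · filter_upwards [hf, hg, Lp.coeFn_add (a • f) (b • g), Lp.coeFn_smul a f,
        Lp.coeFn_smul b g] with ω e1 e2 e3 e4 e5
      rw [hcl, e3, Pi.add_apply, e4, e5, Pi.smul_apply, Pi.smul_apply, e1, e2]
  have hclosed : IsClosed V := by
    refine IsSeqClosed.isClosed fun {f g} hf hg => ?_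
    choose K hK hKγ hfK using hf
    obtain ⟨ns, -, hns⟩ := (tendstoInMeasure_of_tendsto_Lp hg).exists_seq_tendsto_ae
    have hlim : ∀ᵐ ω ∂freqMeasure,
        Tendsto (fun n => S.closedLoop (K (ns n)) ω) atTop (𝓝 (g ω)) := by
      filter_upwards [hns, ae_all_iff.2 hfK] with ω h1 h2
      simpa only [h2] using h1
    -- `K` is the lower block of `T_K`, so an almost everywhere limit of closed loops determines the
    -- limiting controller.
    let Kg : Freq → EuclideanSpace ℂ (Fin du) := fun ω => WithLp.toLp 2 fun j => g ω (Sum.inr j)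
    have hKlim : ∀ᵐ ω ∂freqMeasure, Tendsto (fun n => K (ns n) ω) atTop (𝓝 (Kg ω)) := by
      filter_upwards [hlim] with ω h
      refine ((PiLp.continuous_toLp 2 _).tendsto _).comp (tendsto_pi_nhds.2 fun j => ?_)
      exact ((EuclideanSpace.proj (𝕜 := ℂ) (Sum.inr j : Fin dx ⊕ Fin du)).continuous.tendsto _).comp h
    have hTlim : ∀ᵐ ω ∂freqMeasure,
        Tendsto (fun n => S.closedLoop (K (ns n)) ω) atTop (𝓝 (S.closedLoop Kg ω)) := by
      filter_upwards [hKlim] with ω h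
      have hc : Continuous fun y : EuclideanSpace ℂ (Fin du) => S.closedLoop (fun _ => y) ω := by
        refine (PiLp.continuous_toLp 2 _).comp (continuous_pi fun i => ?_)
        rcases i with i | i
        · simp only [Sum.elim_inl, Matrix.mulVec, dotProduct]
          fun_prop
        · simp only [Sum.elim_inr]
          fun_prop
      exact (hc.tendsto _).comp h
    have hbound : ∀ n, ∀ᵐ ω ∂freqMeasure, ‖S.closedLoop (K (ns n)) ω‖ ≤ γ := fun n => by
      filter_upwards [(hK (ns n)).norm_le] with ω h using h.trans (hKγ _)
    refine ⟨Kg, ⟨.of_tendsto (fun n => (hK (ns n)).1) (γ := γ) (fun n => ?_) hKlim,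
      .of_tendsto (fun n => (hK (ns n)).2) hbound hTlim⟩, hInfNorm_le hγ0 ?_, ?_⟩
    · filter_upwards [hbound n] with ω h
      refine le_trans ?_ h
      rw [← sq_le_sq₀ (norm_nonneg _) (norm_nonneg _), EuclideanSpace.norm_sq_eq,
        EuclideanSpace.norm_sq_eq, Fintype.sum_sum_type]
      exact le_add_of_nonneg_left (by positivity)
    · filter_upwards [hTlim, ae_all_iff.2 hbound] with ω h1 h2
      exact le_of_tendsto h1.norm (Eventually.of_forall h2)
    · filter_upwards [hTlim, hlim] with ω h1 h2 using tendsto_nhds_unique h2 h1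
  obtain ⟨f, ⟨K, hK, hKγ, hf⟩, hmin⟩ := exists_norm_eq_iInf_of_complete_convex
    ⟨_, hC K₀ hK₀ hK₀γ⟩ hclosed.isComplete hconv 0
  refine ⟨K, hK, hKγ, fun K' hK' hK'γ => ?_⟩
  rw [← hnorm f K hf, ← hnorm _ K' (hmem K' hK').coeFn_toLp]
  have h := ciInf_le (f := fun w : V => ‖0 - w.1‖)
    ⟨0, by rintro _ ⟨w, rfl⟩; exact norm_nonneg _⟩ ⟨_, hC K' hK' hK'γ⟩
  rw [← hmin] at h
  simp only [zero_sub, norm_neg] at h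
  gcongr

/-- The solution of the mixed `H_2/H_∞` problem is unique up to null sets. -/
lemma IsMixedOptimal.ae_eq (hK : S.IsMixedOptimal γ K) (hK' : S.IsMixedOptimal γ K') :
    K' =ᵐ[freqMeasure] K := by
  have hq : ∀ ω : Freq, aeval (expj ω)⁻¹ (C (1 / 2) : ℝ[X]) = (1 / 2 : ℂ) := by simp
  have hM := hK.1.filter hK'.1 (C (1 / 2))
  have hcl : ∀ ω, S.closedLoop (fun ω => K ω + aeval (expj ω)⁻¹ (C (1 / 2) : ℝ[X]) •
      (K' ω - K ω)) ω = (1 / 2 : ℂ) • (S.closedLoop K ω + S.closedLoop K' ω) := fun ω => by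
    rw [S.closedLoop_filter (fun ω => aeval (expj ω)⁻¹ (C (1 / 2) : ℝ[X])), hq]
    module
  -- Parallelogram law: the midpoint is feasible, so it costs at least as much as either optimum,
  -- and the integral of the left side is at most zero.
  have hid : ∀ ω, ‖S.closedLoop K' ω - S.closedLoop K ω‖ ^ 2
      = 2 * ‖S.closedLoop K ω‖ ^ 2 + 2 * ‖S.closedLoop K' ω‖ ^ 2
        - 4 * ‖S.closedLoop (fun ω => K ω + aeval (expj ω)⁻¹ (C (1 / 2) : ℝ[X]) •
      (K' ω - K ω)) ω‖ ^ 2 := fun ω => by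
    have h := parallelogram_law_with_norm ℂ (S.closedLoop K' ω) (S.closedLoop K ω)
    rw [hcl, norm_smul, add_comm (S.closedLoop K ω)]
    norm_num
    nlinarith [h]
  have hle := hK.2.2 _ hM <| hInfNorm_le (hInfNorm_nonneg.trans hK.2.1) <| by
    filter_upwards [hK.1.norm_le, hK'.1.norm_le] with ω h1 h2
    rw [hcl, norm_smul]
    have := norm_add_le (S.closedLoop K ω) (S.closedLoop K' ω)
    have h3 := hK.2.1
    have h4 := hK'.2.1
    norm_num
    linarith
  have hle' := hK'.2.2 _ hK.1 hK.2.1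
  have hint : ∫ ω, ‖S.closedLoop K' ω - S.closedLoop K ω‖ ^ 2 ∂freqMeasure ≤ 0 := by
    simp only [hid]
    rw [integral_sub ((hK.1.integrable_norm_sq.const_mul 2).fun_add
      (hK'.1.integrable_norm_sq.const_mul 2)) (hM.integrable_norm_sq.const_mul 4),
      integral_add (hK.1.integrable_norm_sq.const_mul 2) (hK'.1.integrable_norm_sq.const_mul 2)]
    simp only [integral_const_mul]
    simp only [h2NormSq] at hle hle'
    linarith
  have h0 : 0 ≤ᵐ[freqMeasure] fun ω => ‖S.closedLoop K' ω - S.closedLoop K ω‖ ^ 2 :=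
    ae_of_all _ fun ω => by positivity
  have hz := (integral_eq_zero_iff_of_nonneg_ae h0
    (((hK'.1.2.sub hK.1.2).memLp.mono_exponent le_top).integrable_norm_pow (by norm_num))).1
    (hint.antisymm (integral_nonneg_of_ae h0))
  filter_upwards [hz] with ω h
  have h' : S.closedLoop K' ω = S.closedLoop K ω := by simpa [sub_eq_zero] using h
  ext i
  exact congrFun (congrArg WithLp.ofLp h') (Sum.inr i)

end LTISystem

/-! ### First-order optimality and irrationality of the controller -/

namespace LTISystem

variable {dx du : ℕ} {S : LTISystem dx du} {K K' : Freq → EuclideanSpace ℂ (Fin du)} {γ : ℝ}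

lemma norm_aeval_le_sum (q : ℝ[X]) (ω : Freq) :
    ‖aeval (expj ω)⁻¹ q‖ ≤ ∑ k ∈ Finset.range (q.natDegree + 1), ‖q.coeff k‖ := by
  rw [aeval_eq_sum_range]
  refine (norm_sum_le _ _).trans (Finset.sum_le_sum fun k _ => ?_)
  rw [norm_smul, norm_pow, norm_expj_inv, one_pow, mul_one]

lemma norm_sq_add_smul {E : Type*} [NormedAddCommGroup E] [InnerProductSpace ℂ E] (x y : E)
    (ε : ℝ) (c : ℂ) : ‖x + ((ε : ℂ) * c) • y‖ ^ 2
      = ‖x‖ ^ 2 + ε * (2 * (c * inner ℂ x y).re) + ε ^ 2 * (‖c‖ ^ 2 * ‖y‖ ^ 2) := by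
  rw [norm_add_sq (𝕜 := ℂ), inner_smul_right, norm_smul, norm_mul, mul_assoc]
  simp only [RCLike.re_to_complex, Complex.re_ofReal_mul, Complex.norm_real, mul_pow,
    Real.norm_eq_abs, sq_abs]
  ring

lemma aestronglyMeasurable_aeval (q : ℝ[X]) :
    AEStronglyMeasurable (fun ω => aeval (expj ω)⁻¹ q) freqMeasure := by
  have h : Continuous fun ω => (expj ω)⁻¹ := continuous_expj.inv₀ expj_ne_zero
  exact (q.continuous_aeval.comp h).aestronglyMeasurable

lemma IsAdmissible.integrable_filter_inner (hK : S.IsAdmissible K) (hK' : S.IsAdmissible K')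
    (q : ℝ[X]) : Integrable (fun ω => aeval (expj ω)⁻¹ q *
      inner ℂ (S.closedLoop K ω) (S.closedLoop K' ω - S.closedLoop K ω)) freqMeasure :=
  (hK.integrable_inner hK').bdd_mul (aestronglyMeasurable_aeval q)
    (ae_of_all _ (norm_aeval_le_sum q))

/-- First-order optimality: at a mixed optimal controller, the objective is stationary in every
direction which is filtered by a polynomial dominated by the slack of the constraint. -/
lemma IsMixedOptimal.stationary (hK : S.IsMixedOptimal γ K) (hK' : S.IsAdmissible K') (q : ℝ[X])
    {c : ℝ} (hq : ∀ᵐ ω ∂freqMeasure,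
      ‖aeval (expj ω)⁻¹ q‖ ≤ c * (γ ^ 2 - ‖S.closedLoop K ω‖ ^ 2)) :
    ∫ ω, (aeval (expj ω)⁻¹ q *
      inner ℂ (S.closedLoop K ω) (S.closedLoop K' ω - S.closedLoop K ω)).re ∂freqMeasure = 0 := by
  have hγ : 0 ≤ γ := hInfNorm_nonneg.trans hK.2.1
  obtain ⟨B, hB⟩ : ∃ B, ∀ ω, ‖aeval (expj ω)⁻¹ q‖ ≤ B := ⟨_, norm_aeval_le_sum q⟩
  have hB0 : 0 ≤ B := (norm_nonneg _).trans (hB 0)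
  let d := S.hInfNorm K' + S.hInfNorm K
  have hd0 : 0 ≤ d := add_nonneg hInfNorm_nonneg hInfNorm_nonneg
  have hd : ∀ᵐ ω ∂freqMeasure, ‖S.closedLoop K' ω - S.closedLoop K ω‖ ≤ d := by
    filter_upwards [hK.1.norm_le, hK'.norm_le] with ω h1 h2
    exact (norm_sub_le _ _).trans (add_le_add h2 h1)
  have hT : ∀ᵐ ω ∂freqMeasure, ‖S.closedLoop K ω‖ ≤ γ := by
    filter_upwards [hK.1.norm_le] with ω h using h.trans hK.2.1
  let r := ∫ ω, (aeval (expj ω)⁻¹ q *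
      inner ℂ (S.closedLoop K ω) (S.closedLoop K' ω - S.closedLoop K ω)).re ∂freqMeasure
  let s := ∫ ω, ‖aeval (expj ω)⁻¹ q‖ ^ 2 * ‖S.closedLoop K' ω - S.closedLoop K ω‖ ^ 2 ∂freqMeasure
  let P : ℝ → Freq → EuclideanSpace ℂ (Fin du) := fun ε ω =>
    K ω + aeval (expj ω)⁻¹ (C ε * q) • (K' ω - K ω)
  have hP : ∀ ε, S.IsAdmissible (P ε) := fun ε => hK.1.filter hK' _
  have hPn : ∀ ε ω, ‖S.closedLoop (P ε) ω‖ ^ 2 = ‖S.closedLoop K ω‖ ^ 2 +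
      ε * (2 * (aeval (expj ω)⁻¹ q *
        inner ℂ (S.closedLoop K ω) (S.closedLoop K' ω - S.closedLoop K ω)).re) +
      ε ^ 2 * (‖aeval (expj ω)⁻¹ q‖ ^ 2 * ‖S.closedLoop K' ω - S.closedLoop K ω‖ ^ 2) :=
    fun ε ω => by
      rw [S.closedLoop_filter (fun ω => aeval (expj ω)⁻¹ (C ε * q)), map_mul, aeval_C,
        Complex.coe_algebraMap, norm_sq_add_smul]
  have hi : Integrable (fun ω => (aeval (expj ω)⁻¹ q *
      inner ℂ (S.closedLoop K ω) (S.closedLoop K' ω - S.closedLoop K ω)).re) freqMeasure :=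
    (hK.1.integrable_filter_inner hK' q).re
  have hs : Integrable (fun ω => ‖aeval (expj ω)⁻¹ q‖ ^ 2 *
      ‖S.closedLoop K' ω - S.closedLoop K ω‖ ^ 2) freqMeasure := by
    have := (((hK'.2.sub hK.1.2).filter q).memLp.mono_exponent le_top).integrable_norm_pow
      (p := 2) (by norm_num)
    simpa only [norm_smul, mul_pow] using this
  have hPh : ∀ ε, S.h2NormSq (P ε) = S.h2NormSq K + ε * (2 * r) + ε ^ 2 * s := fun ε => by
    have h1 := hK.1.integrable_norm_sq
    have h2 := (hi.const_mul 2).const_mul ε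
    have h3 := hs.const_mul (ε ^ 2)
    simp only [h2NormSq, hPn]
    rw [integral_add (h1.fun_add h2) h3, integral_add h1 h2]
    simp only [integral_const_mul]
    rfl
  have hfeas : ∀ᶠ ε in 𝓝 (0 : ℝ), S.hInfNorm (P ε) ≤ γ := by
    -- The squared norm grows by at most `‖w‖ (|ε| 2γd + ε² B d²)`, with `w` the filter value. As
    -- `‖w‖` is at most `c` times the slack, the growth fits into the slack once this expression is
    -- at most 1, for either sign of `ε`.
    have hc : Continuous fun ε : ℝ => c * (|ε| * (2 * γ * d) + ε ^ 2 * (B * d ^ 2)) := by fun_prop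
    have hc0 : c * (|0| * (2 * γ * d) + 0 ^ 2 * (B * d ^ 2)) < 1 := by simp
    have hev := (hc.tendsto 0).eventually_le_const hc0
    filter_upwards [hev] with ε hε
    refine hInfNorm_le hγ ?_
    filter_upwards [hd, hT, hq] with ω h1 h2 h3
    rw [← sq_le_sq₀ (norm_nonneg _) hγ, hPn]
    set x := S.closedLoop K ω
    set y := S.closedLoop K' ω - x
    set w := aeval (expj ω)⁻¹ q
    have hre : ε * (2 * (w * inner ℂ x y).re) ≤ |ε| * (2 * (‖w‖ * (γ * d))) := by
      refine (le_abs_self _).trans ?_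
      rw [abs_mul, abs_mul, abs_two]
      gcongr
      refine (Complex.abs_re_le_norm _).trans ?_
      rw [norm_mul]
      gcongr
      exact (norm_inner_le_norm x y).trans (by gcongr)
    have hsq : ε ^ 2 * (‖w‖ ^ 2 * ‖y‖ ^ 2) ≤ ε ^ 2 * (‖w‖ * B * d ^ 2) := by
      rw [sq ‖w‖]
      gcongr
      exact hB ω
    have hslack : 0 ≤ γ ^ 2 - ‖x‖ ^ 2 := sub_nonneg.2 (by gcongr)
    have hm : ‖w‖ * (|ε| * (2 * γ * d) + ε ^ 2 * (B * d ^ 2))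
        ≤ c * (γ ^ 2 - ‖x‖ ^ 2) * (|ε| * (2 * γ * d) + ε ^ 2 * (B * d ^ 2)) := by
      gcongr
    nlinarith [mul_le_mul_of_nonneg_left hε hslack]
  have hmin : IsLocalMin (fun ε : ℝ => ε * (2 * r) + ε ^ 2 * s) 0 := by
    filter_upwards [hfeas] with ε hε
    have := hK.2.2 _ (hP ε) hε
    rw [hPh] at this
    simp only [zero_mul, ne_eq, OfNat.ofNat_ne_zero, not_false_eq_true, zero_pow, add_zero]
    linarith
  have hder : HasDerivAt (fun ε : ℝ => ε * (2 * r) + ε ^ 2 * s) (2 * r) 0 := by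
    have h1 := ((hasDerivAt_id (0 : ℝ)).mul_const (2 * r)).fun_add
      (((hasDerivAt_id (0 : ℝ)).pow 2).mul_const s)
    simpa using h1
  have := hmin.hasDerivAt_eq_zero hder
  have hr : r = 0 := by linarith
  exact hr

/-- Half the derivative of the `H_2` objective at `K`, in the direction of `K' - K` filtered by a
polynomial in the delay. -/
def IsAdmissible.slope (hK : S.IsAdmissible K) (hK' : S.IsAdmissible K') : ℝ[X] →ₗ[ℝ] ℝ where
  toFun q := ∫ ω, (aeval (expj ω)⁻¹ q *
    inner ℂ (S.closedLoop K ω) (S.closedLoop K' ω - S.closedLoop K ω)).re ∂freqMeasure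
  map_add' p q := by
    simp only [map_add, add_mul, Complex.add_re]
    exact integral_add (hK.integrable_filter_inner hK' p).re
      (hK.integrable_filter_inner hK' q).re
  map_smul' a q := by
    simp only [map_smul, smul_mul_assoc, Complex.smul_re, RingHom.id_apply]
    exact integral_smul _ _

/-- The slope at `X^n` is the real part of the `n`-th Fourier coefficient of a bounded function. -/
lemma IsAdmissible.tendsto_slope (hK : S.IsAdmissible K) (hK' : S.IsAdmissible K') :
    Tendsto (fun n : ℕ => hK.slope hK' (X ^ n)) atTop (𝓝 0) := by
  have h2 : MemLp (fun ω => inner ℂ (S.closedLoop K ω)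
      (S.closedLoop K' ω - S.closedLoop K ω)) 2 freqMeasure := by
    refine MemLp.of_bound (hK.integrable_inner hK').1
      (S.hInfNorm K * (S.hInfNorm K' + S.hInfNorm K)) ?_
    filter_upwards [hK.norm_le, hK'.norm_le] with ω h1 h2
    exact (norm_inner_le_norm _ _).trans (mul_le_mul h1
      ((norm_sub_le _ _).trans (add_le_add h2 h1)) (norm_nonneg _) hInfNorm_nonneg)
  have h3 : Tendsto (fun n : ℕ => fourierCoeff (fun ω => inner ℂ (S.closedLoop K ω)
      (S.closedLoop K' ω - S.closedLoop K ω)) (n : ℤ)) atTop (𝓝 0) := by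
    have := (tendsto_fourierCoeff h2).comp (Nat.cast_injective (R := ℤ)).tendsto_cofinite
    rwa [Nat.cofinite_eq_atTop] at this
  refine ((Complex.continuous_re.tendsto 0).comp h3).congr fun n => ?_
  have h4 := integral_re (𝕜 := ℂ) (hK.integrable_filter_inner hK' (X ^ n))
  refine Eq.trans ?_ h4.symm
  simp only [Function.comp_apply, fourierCoeff, ← expj_zpow, smul_eq_mul, map_pow, aeval_X,
    zpow_neg, zpow_natCast, inv_pow, RCLike.re_to_complex]

/-- If the squared norm of the closed loop at a mixed optimal controller is rational, then the
constraint is active almost everywhere or the controller is `H_2` optimal. -/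
lemma IsMixedOptimal.active_or_isH2Optimal (hK : S.IsMixedOptimal γ K)
    (hrat : IsRational fun ω => ((‖S.closedLoop K ω‖ ^ 2 : ℝ) : ℂ)) (hK' : S.IsH2Optimal K') :
    (∀ᵐ ω ∂freqMeasure, ‖S.closedLoop K ω‖ ^ 2 = γ ^ 2) ∨ S.IsH2Optimal K := by
  have hT : ∀ᵐ ω ∂freqMeasure, ‖S.closedLoop K ω‖ ≤ γ := by
    filter_upwards [hK.1.norm_le] with ω h using h.trans hK.2.1
  obtain ⟨p, q, hq, hpq⟩ := (IsRational.const ((γ ^ 2 : ℝ) : ℂ)).sub hrat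
  by_cases hp : p = 0
  · left
    filter_upwards [hpq] with ω h
    rw [hp, eval_zero, zero_div, sub_eq_zero] at h
    exact_mod_cast h.symm
  right
  obtain ⟨M, c, hc, hM, hlow⟩ := exists_unimodular_lower_bound hp
  obtain ⟨Q, hQ⟩ : ∃ Q, ∀ ω, ‖q.eval (expj ω)‖ ≤ Q := by
    obtain ⟨Q, hQ⟩ := isCompact_univ.exists_bound_of_continuousOn (f := fun ω => q.eval (expj ω))
      (q.continuous.comp continuous_expj).continuousOn
    exact ⟨Q, fun ω => hQ ω trivial⟩
  have hslack : ∀ᵐ ω ∂freqMeasure, c * (M.map fun α => ‖expj ω - α‖).prod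
      ≤ Q * (γ ^ 2 - ‖S.closedLoop K ω‖ ^ 2) := by
    filter_upwards [hpq, ae_eval_expj_ne_zero hq, hT] with ω h1 h2 h3
    have hs : 0 ≤ γ ^ 2 - ‖S.closedLoop K ω‖ ^ 2 := sub_nonneg.2 (by gcongr)
    have h4 : p.eval (expj ω)
        = ((γ ^ 2 - ‖S.closedLoop K ω‖ ^ 2 : ℝ) : ℂ) * q.eval (expj ω) := by
      rw [← div_eq_iff h2, ← h1]
      push_cast
      rfl
    refine (hlow _ (norm_expj ω)).trans ?_
    rw [h4, norm_mul, Complex.norm_real, Real.norm_of_nonneg hs, mul_comm]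
    gcongr
    exact hQ ω
  -- A further delay `X^n` has modulus one on the circle, so one constant serves all shifts.
  have hfilter : ∀ n : ℕ, ∀ᵐ ω ∂freqMeasure, ‖aeval (expj ω)⁻¹ (conjProd M * X ^ n)‖
      ≤ (2 ^ M.card / c * Q) * (γ ^ 2 - ‖S.closedLoop K ω‖ ^ 2) := fun n => by
    filter_upwards [hslack] with ω h
    rw [map_mul, norm_mul, map_pow, aeval_X, norm_pow, norm_expj_inv, one_pow, mul_one]
    refine (norm_aeval_conjProd_le M hM (norm_expj ω)).trans ?_
    rw [mul_assoc, div_mul_eq_mul_div, le_div_iff₀ hc, mul_assoc, mul_comm _ c]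
    gcongr
  have h0 := real_functional_eq_zero _ (hK.1.tendsto_slope hK'.1) M hM (hK.1.slope hK'.1) (fun _ => rfl) fun n =>
    hK.stationary hK'.1 _ (hfilter n)
  have hid : ∀ ω, ‖S.closedLoop K' ω‖ ^ 2 = ‖S.closedLoop K ω‖ ^ 2 +
      2 * (inner ℂ (S.closedLoop K ω) (S.closedLoop K' ω - S.closedLoop K ω)).re +
      ‖S.closedLoop K' ω - S.closedLoop K ω‖ ^ 2 := fun ω => by
    have := norm_add_sq (𝕜 := ℂ) (S.closedLoop K ω) (S.closedLoop K' ω - S.closedLoop K ω)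
    rwa [add_sub_cancel] at this
  refine ⟨hK.1, fun K'' hK'' => le_trans ?_ (hK'.2 K'' hK'')⟩
  have h1 := hK.1.integrable_norm_sq
  have h2 : Integrable (fun ω => 2 * (inner ℂ (S.closedLoop K ω)
      (S.closedLoop K' ω - S.closedLoop K ω)).re) freqMeasure :=
    (hK.1.integrable_inner hK'.1).re.const_mul 2
  have h3 : Integrable (fun ω => ‖S.closedLoop K' ω - S.closedLoop K ω‖ ^ 2) freqMeasure :=
    ((hK'.1.2.sub hK.1.2).memLp.mono_exponent le_top).integrable_norm_pow (by norm_num)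
  have h4 : ∫ ω, (inner ℂ (S.closedLoop K ω)
      (S.closedLoop K' ω - S.closedLoop K ω)).re ∂freqMeasure = 0 := by
    simpa only [IsAdmissible.slope, LinearMap.coe_mk, AddHom.coe_mk, map_one, one_mul] using h0
  -- The slope at the filter 1 is the cross term of the expansion about `K`; once it vanishes,
  -- Pythagoras shows that `K` costs no more than `K'`.
  have h5 : S.h2NormSq K' = S.h2NormSq K +
      ∫ ω, ‖S.closedLoop K' ω - S.closedLoop K ω‖ ^ 2 ∂freqMeasure := by
    simp only [h2NormSq, hid]
    rw [integral_add (h1.fun_add h2) h3, integral_add h1 h2, integral_const_mul, h4, mul_zero,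
      add_zero]
  rw [h5]
  exact le_add_of_nonneg_right (integral_nonneg fun ω => by positivity)

/-- A mixed optimal controller is not rational. -/
lemma IsMixedOptimal.not_isRationalVec (hγ : γ ∈ Set.Ioo S.gammaInf S.gammaTwo)
    (hK : S.IsMixedOptimal γ K) : ¬ IsRationalVec K := by
  intro hrat
  obtain ⟨K₂, hK₂⟩ := exists_isH2Optimal hγ
  obtain ⟨K₀, hK₀, hlt⟩ := exists_strictly_feasible hγ
  rcases hK.active_or_isH2Optimal (S.isRational_norm_sq_closedLoop hrat) hK₂ with h | h
  -- An everywhere active constraint gives cost `γ²`, whereas `K₀` costs at most `‖T_{K₀}‖_∞² < γ²`.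
  · have h1 := hK.2.2 K₀ hK₀ hlt.le
    rw [h2NormSq_eq_of_ae h] at h1
    have h2 := pow_lt_pow_left₀ hlt hInfNorm_nonneg two_ne_zero
    linarith [hK₀.h2NormSq_le]
  · linarith [gammaTwo_le h, hK.2.1, hγ.2]

/-! ### Saddle points and irrationality of the spectrum -/

lemma IsAdmissible.integrable_norm_sq_mul (hK : S.IsAdmissible K) {Λ : Freq → ℝ}
    (hΛ : Integrable Λ freqMeasure) :
    Integrable (fun ω => ‖S.closedLoop K ω‖ ^ 2 * Λ ω) freqMeasure := by
  refine hΛ.bdd_mul (c := S.hInfNorm K ^ 2) hK.integrable_norm_sq.1 ?_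
  filter_upwards [hK.norm_le] with ω h
  rw [norm_pow, norm_norm]
  gcongr

lemma IsAdmissible.lagrangian_eq (hK : S.IsAdmissible K) {Λ : Freq → ℝ}
    (hΛ : Integrable Λ freqMeasure) : S.lagrangian γ K Λ
      = S.h2NormSq K + ∫ ω, (‖S.closedLoop K ω‖ ^ 2 - γ ^ 2) * Λ ω ∂freqMeasure := by
  have h1 := hK.integrable_norm_sq
  have h2 := hK.integrable_norm_sq_mul hΛ
  simp only [lagrangian, h2NormSq, mul_add, mul_one, sub_mul]
  rw [integral_add h1 h2, integral_sub h2 (hΛ.const_mul _), integral_const_mul]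
  ring

/-- At a saddle point the constraint holds, with complementary slackness. -/
lemma IsSaddlePoint.feasible_and_slack {Λ : Freq → ℝ} (h : S.IsSaddlePoint γ K Λ) :
    (∀ᵐ ω ∂freqMeasure, ‖S.closedLoop K ω‖ ^ 2 ≤ γ ^ 2) ∧
      ∀ᵐ ω ∂freqMeasure, (‖S.closedLoop K ω‖ ^ 2 - γ ^ 2) * Λ ω = 0 := by
  obtain ⟨hK, ⟨hΛ, hΛ0⟩, hmax, -⟩ := h
  have hφ : Integrable (fun ω => ‖S.closedLoop K ω‖ ^ 2 - γ ^ 2) freqMeasure :=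
    hK.integrable_norm_sq.sub (integrable_const _)
  have hφΛ : Integrable (fun ω => (‖S.closedLoop K ω‖ ^ 2 - γ ^ 2) * Λ ω) freqMeasure := by
    simp only [sub_mul]
    exact (hK.integrable_norm_sq_mul hΛ).sub (hΛ.const_mul _)
  have hfeas : ∀ᵐ ω ∂freqMeasure, ‖S.closedLoop K ω‖ ^ 2 ≤ γ ^ 2 := by
    -- Adding the constraint violation to `Λ` raises the Lagrangian by the integral of the squared
    -- violation, which maximality forces to be zero.
    have hint : Integrable (fun ω => Λ ω + max (‖S.closedLoop K ω‖ ^ 2 - γ ^ 2) 0) freqMeasure :=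
      hΛ.add hφ.pos_part
    have h1 := hmax _ ⟨hint, by
      filter_upwards [hΛ0] with ω h using add_nonneg h (le_max_right _ _)⟩
    rw [hK.lagrangian_eq hint, hK.lagrangian_eq hΛ, add_le_add_iff_left] at h1
    have h2 : Integrable (fun ω => (‖S.closedLoop K ω‖ ^ 2 - γ ^ 2) *
        max (‖S.closedLoop K ω‖ ^ 2 - γ ^ 2) 0) freqMeasure := by
      simp only [sub_mul]
      exact (hK.integrable_norm_sq_mul hφ.pos_part).sub (hφ.pos_part.const_mul _)
    simp only [mul_add] at h1
    rw [integral_add hφΛ h2, add_le_iff_nonpos_right] at h1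
    have h3 : ∀ x : ℝ, 0 ≤ x * max x 0 := fun x => by
      rcases le_total x 0 with hx | hx
      · simp [hx]
      · exact mul_nonneg hx (le_max_right _ _)
    have h4 := (integral_eq_zero_iff_of_nonneg (fun ω => h3 _) h2).1
      (h1.antisymm (integral_nonneg fun ω => h3 _))
    filter_upwards [h4] with ω h
    by_contra! hlt
    have hpos := sub_pos.2 hlt
    have : (‖S.closedLoop K ω‖ ^ 2 - γ ^ 2) * max (‖S.closedLoop K ω‖ ^ 2 - γ ^ 2) 0 = 0 := h
    rw [max_eq_left hpos.le] at this
    exact (mul_pos hpos hpos).ne' this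
  refine ⟨hfeas, ?_⟩
  -- Testing against `Λ' = 0` makes the integral of the nonpositive function `(‖T_K‖² - γ²) Λ`
  -- nonnegative.
  have h1 := hmax 0 ⟨integrable_zero _ _ _, EventuallyLE.refl _ _⟩
  rw [hK.lagrangian_eq (integrable_zero _ _ _), hK.lagrangian_eq hΛ, add_le_add_iff_left] at h1
  simp only [Pi.zero_apply, mul_zero, integral_zero] at h1
  have h2 : 0 ≤ᵐ[freqMeasure] fun ω => -((‖S.closedLoop K ω‖ ^ 2 - γ ^ 2) * Λ ω) := by
    filter_upwards [hfeas, hΛ0] with ω h3 h4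
    exact neg_nonneg.2 (mul_nonpos_of_nonpos_of_nonneg (sub_nonpos.2 h3) h4)
  have h3 := (integral_eq_zero_iff_of_nonneg_ae h2 hφΛ.neg).1 <|
    le_antisymm (by rw [integral_neg]; linarith) (integral_nonneg_of_ae h2)
  filter_upwards [h3] with ω h4 using neg_eq_zero.1 h4

/-- No optimal spectrum is rational. -/
lemma IsOptimalSpectrum.not_isRational (hγ : γ ∈ Set.Ioo S.gammaInf S.gammaTwo) {N : Freq → ℝ}
    (hN : S.IsOptimalSpectrum γ N) : ¬ IsRational fun ω => (N ω : ℂ) := by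
  intro hrat
  obtain ⟨K, Λ, hsad, hNΛ⟩ := hN
  obtain ⟨hfeas, hslack⟩ := hsad.feasible_and_slack
  obtain ⟨hK, ⟨hΛ, hΛ0⟩, -, hmin⟩ := hsad
  have hγ0 : 0 ≤ γ := gammaInf_nonneg.trans hγ.1.le
  have hrΛ : IsRational fun ω => (Λ ω : ℂ) := (hrat.sub (.const 1)).congr <| by
    filter_upwards [hNΛ] with ω h
    simp [h]
  obtain ⟨p, q, hq, hpq⟩ := hrΛ
  by_cases hp : p = 0
  · have hΛz : ∀ᵐ ω ∂freqMeasure, Λ ω = 0 := by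
      filter_upwards [hpq] with ω h
      simpa [hp] using h
    have hL : ∀ K', S.IsAdmissible K' → S.lagrangian γ K' Λ = S.h2NormSq K' := fun K' hK' => by
      rw [hK'.lagrangian_eq hΛ, integral_eq_zero_of_ae, add_zero]
      filter_upwards [hΛz] with ω h
      simp [h]
    have hopt : S.IsH2Optimal K := ⟨hK, fun K' hK' => by
      rw [← hL K hK, ← hL K' hK']
      exact hmin K' hK'⟩
    have : S.hInfNorm K ≤ γ := hInfNorm_le hγ0 <| by
      filter_upwards [hfeas] with ω h using le_of_sq_le_sq h hγ0
    linarith [gammaTwo_le hopt, hγ.2]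
  · have hact : ∀ᵐ ω ∂freqMeasure, ‖S.closedLoop K ω‖ ^ 2 = γ ^ 2 := by
      filter_upwards [hslack, hpq, ae_eval_expj_ne_zero hp, ae_eval_expj_ne_zero hq]
        with ω h1 h2 h3 h4
      refine sub_eq_zero.1 ((mul_eq_zero.1 h1).resolve_right fun h5 => ?_)
      rw [h5, Complex.ofReal_zero, eq_comm] at h2
      exact div_ne_zero h3 h4 h2
    obtain ⟨K₀, hK₀, hlt⟩ := exists_strictly_feasible hγ
    -- The Lagrangian at `K` equals `γ²`; at `K₀` it is at most the cost of `K₀`, as the penalty is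
    -- nonpositive, hence below `γ²`.
    have h1 := hmin K₀ hK₀
    rw [hK.lagrangian_eq hΛ, hK₀.lagrangian_eq hΛ, h2NormSq_eq_of_ae hact,
      integral_eq_zero_of_ae hslack, add_zero] at h1
    have h2 := pow_lt_pow_left₀ hlt hInfNorm_nonneg two_ne_zero
    have h3 : ∫ ω, (‖S.closedLoop K₀ ω‖ ^ 2 - γ ^ 2) * Λ ω ∂freqMeasure ≤ 0 := by
      refine integral_nonpos_of_ae ?_
      filter_upwards [hK₀.norm_le, hΛ0] with ω h4 h5
      refine mul_nonpos_of_nonpos_of_nonneg (sub_nonpos.2 ?_) h5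
      have := h4.trans hlt.le
      gcongr
    linarith [hK₀.h2NormSq_le]

end LTISystem

end MixedControl

end

theorem corollary1 {dx du : ℕ} (S : MixedControl.LTISystem dx du)
    (hu : MixedControl.IsStabilizable S.A S.Bu) (hw : MixedControl.IsStabilizable S.A S.Bw)
    (γ : ℝ) (hγ : γ ∈ Set.Ioo S.gammaInf S.gammaTwo) :
    -- the optimal controller exists and is unique up to null sets
    (∃ K, S.IsMixedOptimal γ K ∧
      ∀ K', S.IsMixedOptimal γ K' → K' =ᵐ[MixedControl.freqMeasure] K) ∧
    -- the optimal spectrum is not rational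
    (∀ N : MixedControl.Freq → ℝ, S.IsOptimalSpectrum γ N →
      ¬ MixedControl.IsRational (fun ω => (N ω : ℂ))) ∧
    -- the optimal controller is not rational and has no finite-dimensional realization
    (∀ K, S.IsMixedOptimal γ K →
      ¬ MixedControl.IsRationalVec K ∧ ¬ MixedControl.HasStateSpaceRealization K) := by
  obtain ⟨K₀, hK₀, hlt⟩ := MixedControl.LTISystem.exists_strictly_feasible hγ
  obtain ⟨K, hK⟩ := MixedControl.LTISystem.exists_isMixedOptimal ⟨K₀, hK₀, hlt.le⟩
  exact ⟨⟨K, hK, fun K' hK' => hK.ae_eq hK'⟩, fun N hN => hN.not_isRational hγ,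
    fun K hK => ⟨hK.not_isRationalVec hγ, fun h => hK.not_isRationalVec hγ
      (MixedControl.isRationalVec_of_hasStateSpaceRealization hK.1.1 h)⟩⟩
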